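/- Let $N\ge 2$. For $\Lambda<0$, real functions $m(r)$, $S(r)$ and $\omega_1(r),\dots,\omega_{N-1}(r)$ (with $\omega_0=\omega_N=0$) satisfy the static, spherically symmetric, purely magnetic $\mathfrak{su}(N)$ Einstein--Yang--Mills (EYM) field equations for the metric $$ds^2=-\mu S^2\,dt^2+\mu^{-1}dr^2+r^2(d\theta^2+\sin^2\theta\,d\phi^2),\qquad \mu=1-\frac{2m}{r}-\frac{\Lambda r^2}{3},$$ if $$r^2\mu\,\omega_j''+\Big(2m-2r^3p_\theta-\frac{2\Lambda r^3}{3}\Big)\omega_j'+W_j\omega_j=0\quad(1\le j\le N-1),\qquad m'=\mu G+r^2p_\theta,\qquad \frac{S'}{S}=\frac{2G}{r},$$ where $$p_\theta=\frac1{4r^4}\sum_{j=1}^N\big(\omega_j^2-\omega_{j-1}^2-N-1+2j\big)^2,\qquad W_j=1-\omega_j^2+\tfrac12\big(\omega_{j-1}^2+\omega_{j+1}^2\big),\qquad G=\sum_{j=1}^{N-1}(\omega_j')^2 .$$ A black hole solution with event horizon radius $r_h>0$ is a solution that is regular (differentiable, with each $\omega_j$ twice differentiable) and satisfies these equations for all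 $r\ge r_h$, such that: $m$, $S$, $\omega_j$ are analytic at $r=r_h$; $\mu(r_h)=0$, $\mu'(r_h)>0$, $\mu(r)>0$ for all $r>r_h$, and $S(r)>0$ for all $r\ge r_h$; and near infinity $m$, $S$, $\omega_j$ are given by convergent power series in $r^{-1}$, with $S\to1$ as $r\to\infty$ (so that $m$ and $\omega_j$ tend to finite limits). **Proposition.** Fix $N\ge2$, $r_h>0$ and non-zero real numbers $a_1,\dots,a_{N-1}$. Then there is $L>0$ such that for every $\Lambda<0$ with $|\Lambda|>L$ there exists a black hole solution of the $\mathfrak{su}(N)$ EYM field equations with event horizon radius $r_h$ and $\omega_j(r_h)=a_j$ for all $j$, such that no gauge function $\omega_j$, $1\le j\le N-1$, has a zero in $[r_h,\infty)$. -/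

import Mathlib

open Filter Topology

noncomputable section

namespace EYM

/-- The metric function `μ(r) = 1 - 2 m(r) / r - Λ r² / 3` of the static spherically symmetric metric
`ds² = -μ S² dt² + μ⁻¹ dr² + r² (dθ² + sin² θ dφ²)`. -/
def mu (Λ : ℝ) (m : ℝ → ℝ) (r : ℝ) : ℝ :=
  1 - 2 * m r / r - Λ * r ^ 2 / 3

/-- The tangential pressure
`p_θ(r) = (1 / (4 r⁴)) ∑_{j=1}^{N} (ω_j² - ω_{j-1}² - N - 1 + 2 j)²`. -/
def pTheta (N : ℕ) (ω : ℕ → ℝ → ℝ) (r : ℝ) : ℝ :=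
  1 / (4 * r ^ 4) *
    ∑ j ∈ Finset.Icc 1 N, ((ω j r) ^ 2 - (ω (j - 1) r) ^ 2 - (N : ℝ) - 1 + 2 * (j : ℝ)) ^ 2

/-- `W_j = 1 - ω_j² + (ω_{j-1}² + ω_{j+1}²) / 2`, used for `1 ≤ j ≤ N - 1`. -/
def W (ω : ℕ → ℝ → ℝ) (j : ℕ) (r : ℝ) : ℝ :=
  1 - (ω j r) ^ 2 + 1 / 2 * ((ω (j - 1) r) ^ 2 + (ω (j + 1) r) ^ 2)

/-- `G = ∑_{j=1}^{N-1} (ω_j')²`. -/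
def G (N : ℕ) (ω : ℕ → ℝ → ℝ) (r : ℝ) : ℝ :=
  ∑ j ∈ Finset.Icc 1 (N - 1), (deriv (ω j) r) ^ 2

/-- The static, spherically symmetric, purely magnetic `su(N)` Einstein-Yang-Mills equations with
cosmological constant `Λ`, at the radius `r`, for the metric functions `m`, `S` and the gauge
functions `ω 1, …, ω (N - 1)`; the convention `ω 0 = ω N = 0` is imposed separately. -/
structure FieldEquationsAt (N : ℕ) (Λ : ℝ) (m S : ℝ → ℝ) (ω : ℕ → ℝ → ℝ) (r : ℝ) : Prop where
  /-- The Yang-Mills equations. -/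
  yangMills : ∀ j, 1 ≤ j → j ≤ N - 1 →
    r ^ 2 * mu Λ m r * deriv (deriv (ω j)) r
      + (2 * m r - 2 * r ^ 3 * pTheta N ω r - 2 * Λ * r ^ 3 / 3) * deriv (ω j) r
      + W ω j r * ω j r = 0
  /-- The Einstein equation for `m`. -/
  einstein_m : deriv m r = mu Λ m r * G N ω r + r ^ 2 * pTheta N ω r
  /-- The Einstein equation for `S`. -/
  einstein_S : deriv S r / S r = 2 * G N ω r / r

/-- `f` has a convergent power series expansion in `r⁻¹` near infinity, with constant term `L`. -/
def RegularAtInfinity (f : ℝ → ℝ) (L : ℝ) : Prop :=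
  ∃ g : ℝ → ℝ, AnalyticAt ℝ g 0 ∧ g 0 = L ∧ ∀ᶠ r in atTop, f r = g r⁻¹

/-- `(m, S, ω 1, …, ω (N - 1))` is an asymptotically anti-de Sitter `su(N)` Einstein-Yang-Mills
black hole with cosmological constant `Λ` and a regular non-extremal event horizon at `r = rh`.
Only the values on `[rh, ∞)` (and germs at `rh`) matter, and only the indices `0 ≤ j ≤ N` of `ω`. -/
structure IsBlackHole (N : ℕ) (Λ rh : ℝ) (m S : ℝ → ℝ) (ω : ℕ → ℝ → ℝ) : Prop where
  /-- The convention `ω_0 = ω_N = 0`. -/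
  omega_zero : ∀ r, ω 0 r = 0
  omega_N : ∀ r, ω N r = 0
  /-- All field variables have regular Taylor expansions at the event horizon. -/
  analytic_m : AnalyticAt ℝ m rh
  analytic_S : AnalyticAt ℝ S rh
  analytic_omega : ∀ j, 1 ≤ j → j ≤ N - 1 → AnalyticAt ℝ (ω j) rh
  /-- The horizon is a simple zero of `μ`, and `μ > 0` outside it. -/
  mu_horizon : mu Λ m rh = 0
  nonextremal : 0 < deriv (mu Λ m) rh
  mu_pos : ∀ r, rh < r → 0 < mu Λ m r
  S_pos : ∀ r, rh ≤ r → 0 < S r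
  /-- The fields are regular and solve the field equations from the horizon to infinity. -/
  differentiable_m : ∀ r, rh ≤ r → DifferentiableAt ℝ m r
  differentiable_S : ∀ r, rh ≤ r → DifferentiableAt ℝ S r
  differentiable_omega : ∀ j, 1 ≤ j → j ≤ N - 1 → ∀ r, rh ≤ r → DifferentiableAt ℝ (ω j) r
  differentiable_deriv_omega : ∀ j, 1 ≤ j → j ≤ N - 1 → ∀ r, rh ≤ r →
    DifferentiableAt ℝ (deriv (ω j)) r
  field_equations : ∀ r, rh ≤ r → FieldEquationsAt N Λ m S ω r
  /-- Boundary conditions at infinity: `m → M`, `S → 1`, `ω_j → ω_{j,∞}`, with regular expansions in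
  `r⁻¹`. -/
  infinity_m : ∃ M : ℝ, RegularAtInfinity m M
  infinity_S : RegularAtInfinity S 1
  infinity_omega : ∀ j, 1 ≤ j → j ≤ N - 1 → ∃ L : ℝ, RegularAtInfinity (ω j) L

end EYM

end

noncomputable section

namespace EYM

/-! ### The real disc algebra of radius `3/2` -/

/-! Large `|Λ|` is a perturbation problem. Put `t = 1 - rh / r`, `e = 1 / (|Λ| rh²)`, `k = 1 / rh²`,
`m = |Λ| rh³ n` and `μ = |Λ| r² · t f(t)`. The horizon and infinity become `t = 0` and `t = 1`, and
`e` enters polynomially. At `e = 0` there is the solution `ω_j = a_j`, `f₀ = (3 - 3t + t²) / 3`, to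
be continued to small `e`.

The leading coefficient `t f` vanishes at the horizon. Integrating from `t = 0` and dividing by `t`
removes this singularity: derivatives give way to the bounded operator `(J h)(t) = ∫₀¹ h(s t) ds`.
With `ω_j = a_j + t J v_j`, the unknowns `f` and `v_j` solve equations built from products and `J`
in a Banach algebra. The real disc algebra of radius `3/2` is used: its elements are analytic at
both ends and real on the real axis, and `f₀` is a unit there (`isUnit_mass`).

At `e = 0` the linearisation in `(f, v)` is `(φ, ψ) ↦ (φ, f₀ ψ)`, which is surjective, so
`exists_solution` yields solutions near `(f₀, 0)` for all small `e`. Closeness in norm gives `f > 0`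
and `ω_j ≠ 0` on `[0, 1]`, and `IsProfile.isBlackHole` returns to the coordinate `r`. -/

/-- The closed complex disc of radius `3/2`. -/
abbrev Disc : Type := Metric.closedBall (0 : ℂ) (3 / 2)

/-- The coordinate function on the disc. -/
def discCoord : C(Disc, ℂ) := ⟨fun z => z.1, by fun_prop⟩

/-- The closure of the real polynomials in the continuous functions on the disc. -/
def discPolynomialClosure : Subalgebra ℝ C(Disc, ℂ) := (Algebra.adjoin ℝ {discCoord}).topologicalClosure

/-- The real disc algebra. -/
def DiscAlgebra : Type := discPolynomialClosure

instance : NormedCommRing DiscAlgebra := inferInstanceAs (NormedCommRing discPolynomialClosure)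

instance : NormedAlgebra ℝ DiscAlgebra := inferInstanceAs (NormedAlgebra ℝ discPolynomialClosure)

instance : CompleteSpace DiscAlgebra :=
  (Subalgebra.isClosed_topologicalClosure _ : IsClosed (discPolynomialClosure : Set
    C(Disc, ℂ))).completeSpace_coe

/-- The scaling of the disc by the projection of `s` to `[0, 1]`. -/
def discScale (s : ℝ) (z : Disc) : Disc :=
  ⟨(Set.projIcc (0 : ℝ) 1 zero_le_one s : ℝ) * z.1, by
    have h := (Set.projIcc (0 : ℝ) 1 zero_le_one s).2
    have hz : ‖z.1‖ ≤ 3 / 2 := mem_closedBall_zero_iff.1 z.2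
    rw [mem_closedBall_zero_iff, norm_mul, Complex.norm_real, Real.norm_of_nonneg h.1]
    calc _ ≤ 1 * (3 / 2 : ℝ) := mul_le_mul h.2 hz (norm_nonneg _) zero_le_one
      _ = _ := one_mul _⟩

theorem continuous_discScale : Continuous fun p : Disc × ℝ => discScale p.2 p.1 := by
  unfold discScale
  have h : Continuous fun s : ℝ => (Set.projIcc (0 : ℝ) 1 zero_le_one s : ℝ) :=
    continuous_subtype_val.comp continuous_projIcc
  refine Continuous.subtype_mk ?_ _
  fun_prop

theorem continuous_comp_discScale (h : C(Disc, ℂ)) (z : Disc) :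
    Continuous fun s : ℝ => h (discScale s z) :=
  h.continuous.comp (continuous_discScale.comp (by fun_prop : Continuous fun s : ℝ => (z, s)))

/-- The average `(J h)(z) = ∫₀¹ h(s z) ds`. -/
def discAverage : C(Disc, ℂ) →L[ℝ] C(Disc, ℂ) :=
  LinearMap.mkContinuous
    { toFun := fun h => ⟨fun z => ∫ s in (0 : ℝ)..1, h (discScale s z),
        intervalIntegral.continuous_parametric_intervalIntegral_of_continuous'
          (f := fun z s => h (discScale s z)) (h.continuous.comp continuous_discScale) 0 1⟩
      map_add' := fun f g => by
        ext z
        exact intervalIntegral.integral_add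
          ((continuous_comp_discScale f z).intervalIntegrable _ _)
          ((continuous_comp_discScale g z).intervalIntegrable _ _)
      map_smul' := fun c f => by
        ext z
        exact intervalIntegral.integral_smul c _ } 1
    (fun h => by
      rw [one_mul]
      refine (ContinuousMap.norm_le _ (norm_nonneg _)).2 fun z => ?_
      have := intervalIntegral.norm_integral_le_of_norm_le_const (a := 0) (b := 1) (C := ‖h‖)
        (f := fun s => h (discScale s z)) (fun s _ => h.norm_coe_le_norm _)
      simpa using this)

theorem discAverage_apply (h : C(Disc, ℂ)) (z : Disc) :
    discAverage h z = ∫ s in (0 : ℝ)..1, h (discScale s z) := rfl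

theorem discAverage_pow (n : ℕ) :
    discAverage (discCoord ^ n) = ((n : ℝ) + 1)⁻¹ • discCoord ^ n := by
  ext z
  rw [discAverage_apply]
  have : ∀ s ∈ Set.uIcc (0 : ℝ) 1, (discCoord ^ n) (discScale s z) = ((s ^ n : ℝ) : ℂ) * z.1 ^ n := by
    intro s hs
    rw [Set.uIcc_of_le zero_le_one] at hs
    simp [discCoord, discScale, Set.projIcc_of_mem zero_le_one hs, mul_pow]
  rw [intervalIntegral.integral_congr this, intervalIntegral.integral_mul_const,
    intervalIntegral.integral_ofReal, integral_pow]
  simp [discCoord]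

/-- The average is continuous and multiplies each monomial by a real factor, so it preserves real
polynomials and hence their closure. -/
theorem discAverage_mem {h : C(Disc, ℂ)} (hh : h ∈ discPolynomialClosure) :
    discAverage h ∈ discPolynomialClosure := by
  refine map_mem_closure discAverage.continuous hh ?_
  intro g hg
  rw [SetLike.mem_coe, Algebra.adjoin_singleton_eq_range_aeval] at hg ⊢
  obtain ⟨p, rfl⟩ := hg
  rw [← Algebra.adjoin_singleton_eq_range_aeval]
  induction p using Polynomial.induction_on' with
  | add p q hp hq => 
    simp only [map_add]
    exact add_mem hp hq
  | monomial n c =>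
    have : (Polynomial.aeval discCoord).toRingHom (Polynomial.monomial n c)
        = c • discCoord ^ n := by
      simp [Polynomial.aeval_monomial, Algebra.smul_def]
    rw [this, map_smul, discAverage_pow]
    exact Subalgebra.smul_mem _ (Subalgebra.smul_mem _
      (pow_mem (Algebra.self_mem_adjoin_singleton _ _) _) _) _

namespace DiscAlgebra

/-- The averaging operator on the disc algebra. -/
def avg : DiscAlgebra →L[ℝ] DiscAlgebra :=
  ContinuousLinearMap.restrict (p := Subalgebra.toSubmodule discPolynomialClosure)
    (q := Subalgebra.toSubmodule discPolynomialClosure) discAverage fun _ h => discAverage_mem h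

/-- The coordinate as an element of the disc algebra. -/
def T : DiscAlgebra :=
  ⟨discCoord, Subalgebra.le_topologicalClosure _ (Algebra.self_mem_adjoin_singleton _ _)⟩

/-- The roots of `3 - 3z + z²` have modulus `√3 > 3/2`. Concretely, an explicit cofactor turns the
polynomial into `27 + T⁶`, and `(3/2)⁶ < 27` makes this invertible by a Neumann series. -/
theorem isUnit_mass : IsUnit ((1 / 3 : ℝ) • (3 - 3 * T + T ^ 2)) := by
  have h6 : ‖-((1 / 27 : ℝ) • T ^ 6)‖ < 1 := by
    change ‖-((1 / 27 : ℝ) • discCoord ^ 6)‖ < 1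
    refine lt_of_le_of_lt ((ContinuousMap.norm_le _ (C := (3 / 2) ^ 6 / 27) (by norm_num)).2
      fun z => ?_) (by norm_num)
    have hz : ‖z.1‖ ≤ 3 / 2 := mem_closedBall_zero_iff.1 z.2
    calc ‖(-((1 / 27 : ℝ) • discCoord ^ 6)) z‖ = ‖z.1‖ ^ 6 / 27 := by
          simp [discCoord, div_eq_inv_mul]
      _ ≤ _ := by gcongr
  have h := isUnit_one_sub_of_norm_lt_one h6
  have e : 1 - -((1 / 27 : ℝ) • T ^ 6) = ((1 / 3 : ℝ) • (3 - 3 * T + T ^ 2)) *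
      ((1 / 9 : ℝ) • (9 + 9 * T + 6 * T ^ 2 + 3 * T ^ 3 + T ^ 4)) := by
    have h1 : (1 / 27 : ℝ) • (27 : DiscAlgebra) = 1 := by
      have : (27 : DiscAlgebra) = algebraMap ℝ DiscAlgebra 27 := (map_ofNat _ 27).symm
      rw [this, Algebra.smul_def, ← map_mul]
      norm_num
    have h2 : (3 - 3 * T + T ^ 2) * (9 + 9 * T + 6 * T ^ 2 + 3 * T ^ 3 + T ^ 4) = 27 + T ^ 6 := by
      ring
    rw [smul_mul_smul_comm, h2, sub_neg_eq_add, show (1 / 3 : ℝ) * (1 / 9) = 1 / 27 by norm_num,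
      smul_add, h1]
  rw [e] at h
  exact isUnit_of_mul_isUnit_left h

/-- The point of the disc obtained by projecting a real number to `[-3/2, 3/2]`. -/
def realPoint (t : ℝ) : Disc :=
  ⟨((Set.projIcc (-(3 / 2) : ℝ) (3 / 2) (by norm_num) t : ℝ) : ℂ), by
    have h := (Set.projIcc (-(3 / 2) : ℝ) (3 / 2) (by norm_num) t).2
    rw [mem_closedBall_zero_iff, Complex.norm_real, Real.norm_eq_abs]
    exact abs_le.2 h⟩

theorem realPoint_val {t : ℝ} (ht : |t| ≤ 3 / 2) : (realPoint t).1 = (t : ℂ) := by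
  simp [realPoint, Set.projIcc_of_mem (by norm_num) (abs_le.1 ht)]

theorem realPoint_im (t : ℝ) : (realPoint t).1.im = 0 := Complex.ofReal_im _

/-- True for real polynomials and closed under limits; this is what makes `eval` multiplicative into
`ℝ`. -/
theorem im_realPoint (a : DiscAlgebra) (t : ℝ) : (a.1 (realPoint t)).im = 0 := by
  have hc : IsClosed {f : C(Disc, ℂ) | (f (realPoint t)).im = 0} :=
    isClosed_eq (Complex.continuous_im.comp (continuous_eval_const _))
      continuous_const
  refine closure_minimal ?_ hc a.2
  intro f hf
  induction hf using Algebra.adjoin_induction with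
  | mem x hx => rw [Set.mem_singleton_iff.1 hx]; exact realPoint_im t
  | algebraMap r => simp
  | add x y _ _ hx hy => 
    simp only [Set.mem_ofPred_eq] at hx hy
    simp [hx, hy]
  | mul x y _ _ hx hy =>
    simp only [Set.mem_ofPred_eq] at hx hy
    simp [hx, hy]

/-- Evaluation at a (projected) real point. -/
def eval (t : ℝ) : DiscAlgebra →ₐ[ℝ] ℝ where
  toFun a := (a.1 (realPoint t)).re
  map_one' := Complex.one_re
  map_zero' := Complex.zero_re
  map_add' a b := Complex.add_re _ _
  map_mul' a b := by
    have h := Complex.mul_re (a.1 (realPoint t)) (b.1 (realPoint t))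
    rwa [im_realPoint, zero_mul, sub_zero] at h
  commutes' r := Complex.ofReal_re r

theorem eval_apply (t : ℝ) (a : DiscAlgebra) : eval t a = (a.1 (realPoint t)).re := rfl

theorem ofReal_eval (t : ℝ) (a : DiscAlgebra) : (eval t a : ℂ) = a.1 (realPoint t) :=
  Complex.ext (by simp [eval_apply]) (by simp [im_realPoint])

theorem abs_eval_le (t : ℝ) (a : DiscAlgebra) : |eval t a| ≤ ‖a‖ :=
  (Complex.abs_re_le_norm _).trans (a.1.norm_coe_le_norm _)

theorem eval_T {t : ℝ} (ht : |t| ≤ 3 / 2) : eval t T = t := by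
  rw [eval_apply]
  change ((realPoint t).1).re = t
  rw [realPoint_val ht, Complex.ofReal_re]

theorem continuous_eval (a : DiscAlgebra) : Continuous fun t => eval t a := by
  have : Continuous realPoint := by
    refine Continuous.subtype_mk ?_ _
    exact Complex.continuous_ofReal.comp (continuous_subtype_val.comp continuous_projIcc)
  exact Complex.continuous_re.comp (a.1.continuous.comp this)

/-- Extension of a function on the disc by zero. -/
def extend (f : C(Disc, ℂ)) (z : ℂ) : ℂ :=
  open Classical in if h : z ∈ Metric.closedBall (0 : ℂ) (3 / 2) then f ⟨z, h⟩ else 0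

theorem differentiableOn_extend (a : DiscAlgebra) :
    DifferentiableOn ℂ (extend a.1) (Metric.ball 0 (3 / 2)) := by
  have ha : a.1 ∈ closure (Algebra.adjoin ℝ {discCoord} : Set C(Disc, ℂ)) := a.2
  obtain ⟨u, hu, hlim⟩ := mem_closure_iff_seq_limit.1 ha
  refine TendstoLocallyUniformlyOn.differentiableOn (F := fun n => extend (u n)) (φ := atTop) ?_
    (Eventually.of_forall fun n => ?_) Metric.isOpen_ball
  · refine TendstoUniformlyOn.tendstoLocallyUniformlyOn ?_
    rw [Metric.tendstoUniformlyOn_iff]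
    intro ε hε
    filter_upwards [Metric.tendsto_nhds.1 hlim ε hε] with n hn z hz
    have hz' := Metric.ball_subset_closedBall hz
    simp only [extend, hz', dif_pos]
    rw [dist_comm]
    exact (ContinuousMap.dist_apply_le_dist _).trans_lt hn
  · have h := hu n
    simp only [SetLike.mem_coe] at h
    generalize u n = f at h
    induction h using Algebra.adjoin_induction with
    | mem x hx => 
      rw [Set.mem_singleton_iff.1 hx]
      refine differentiableOn_id.congr fun z hz => ?_
      simp only [extend, Metric.ball_subset_closedBall hz, dif_pos]
      rfl
    | algebraMap r => 
      refine (differentiableOn_const (r : ℂ)).congr fun z hz => ?_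
      simp only [extend, Metric.ball_subset_closedBall hz, dif_pos]
      simp
    | add x y _ _ hx hy => 
      refine (hx.add hy).congr fun z hz => ?_
      simp only [Pi.add_apply, extend, Metric.ball_subset_closedBall hz, dif_pos]
      rfl
    | mul x y _ _ hx hy =>
      refine (hx.mul hy).congr fun z hz => ?_
      simp only [Pi.mul_apply, extend, Metric.ball_subset_closedBall hz, dif_pos]
      rfl

theorem analyticAt_eval (a : DiscAlgebra) {t : ℝ} (ht : |t| < 3 / 2) :
    AnalyticAt ℝ (fun t => eval t a) t := by
  have hm : (t : ℂ) ∈ Metric.ball (0 : ℂ) (3 / 2) := by simpa using ht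
  have h := ((differentiableOn_extend a).analyticAt (Metric.isOpen_ball.mem_nhds hm)).re_ofReal
  refine h.congr ?_
  have : ∀ᶠ s : ℝ in 𝓝 t, |s| < 3 / 2 := continuous_abs.continuousAt.eventually_lt_const ht
  filter_upwards [this] with s hs
  have hs' : (s : ℂ) ∈ Metric.closedBall (0 : ℂ) (3 / 2) := by simpa using hs.le
  have e : (⟨(s : ℂ), hs'⟩ : Disc) = realPoint s := Subtype.ext (realPoint_val hs.le).symm
  simp only [extend, hs', dif_pos, eval_apply, e]

theorem mul_eval_avg (a : DiscAlgebra) {t : ℝ} (ht : |t| ≤ 3 / 2) :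
    t * eval t (avg a) = ∫ s in (0 : ℝ)..t, eval s a := by
  have h : eval t (avg a) = ∫ s in (0 : ℝ)..1, eval (t * s) a := by
    rw [← Complex.ofReal_inj, ofReal_eval, ← intervalIntegral.integral_ofReal]
    change discAverage a.1 (realPoint t) = _
    rw [discAverage_apply]
    refine intervalIntegral.integral_congr fun s hs => ?_
    rw [Set.uIcc_of_le zero_le_one] at hs
    have hst : |t * s| ≤ 3 / 2 := by
      rw [abs_mul, abs_of_nonneg hs.1]
      nlinarith [abs_nonneg t, hs.1, hs.2]
    simp only [ofReal_eval]
    congr 1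
    refine Subtype.ext ?_
    rw [realPoint_val hst]
    simp [discScale, Set.projIcc_of_mem zero_le_one hs, realPoint_val ht, mul_comm]
  rw [h, intervalIntegral.mul_integral_comp_mul_left (f := fun s => eval s a)]
  simp

/-- Multiplying the average by `t` gives the primitive vanishing at `0`, so a residual equation
times `t` differentiates back to the differential equation. -/
theorem hasDerivAt_mul_eval_avg (a : DiscAlgebra) {t : ℝ} (ht : |t| < 3 / 2) :
    HasDerivAt (fun t => t * eval t (avg a)) (eval t a) t := by
  have h := ((continuous_eval a).integral_hasStrictDerivAt 0 t).hasDerivAt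
  refine h.congr_of_eventuallyEq ?_
  have : ∀ᶠ s : ℝ in 𝓝 t, |s| < 3 / 2 := continuous_abs.continuousAt.eventually_lt_const ht
  filter_upwards [this] with s hs using mul_eval_avg a hs.le

end DiscAlgebra

end EYM

end

noncomputable section

namespace EYM

/-! ### The field equations in a commutative Banach algebra -/

/-- The indices of the gauge functions. -/
abbrev GaugeIndex (N : ℕ) : Type := {j // j ∈ Finset.Icc 1 (N - 1)}

section BanachAlgebra

variable {A : Type*} [NormedCommRing A] [NormedAlgebra ℝ A]

/-- Extension of a family over the gauge indices by zero. -/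
def extendFamily (N : ℕ) (v : GaugeIndex N → A) (j : ℕ) : A :=
  if h : j ∈ Finset.Icc 1 (N - 1) then v ⟨j, h⟩ else 0

/-- The gauge function with horizon value `a j` and derivative `v j`. -/
def omegaElt (N : ℕ) (a : ℕ → ℝ) (T : A) (J : A →L[ℝ] A) (v : GaugeIndex N → A) (j : ℕ) : A :=
  algebraMap ℝ A (if j ∈ Finset.Icc 1 (N - 1) then a j else 0) + T * J (extendFamily N v j)

/-- The sum of the squares of the derivatives of the gauge functions. -/
def kineticElt (N : ℕ) (v : GaugeIndex N → A) : A :=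
  ∑ j ∈ Finset.Icc 1 (N - 1), extendFamily N v j * extendFamily N v j

/-- The sum of squares in the tangential pressure, for gauge functions `w`. -/
def potentialElt (N : ℕ) (w : ℕ → A) : A :=
  ∑ j ∈ Finset.Icc 1 N,
    ((w j) ^ 2 - (w (j - 1)) ^ 2 - algebraMap ℝ A N - 1 + algebraMap ℝ A (2 * j)) ^ 2

/-- The potential coefficient of the Yang-Mills equation, for gauge functions `w`. -/
def weightElt (w : ℕ → A) (j : ℕ) : A :=
  1 - (w j) ^ 2 + (1 / 2 : ℝ) • ((w (j - 1)) ^ 2 + (w (j + 1)) ^ 2)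

/-- The residual of the integrated Einstein equation for the mass function. -/
def einsteinResidual (N : ℕ) (a : ℕ → ℝ) (k : ℝ) (T : A) (J : A →L[ℝ] A)
    (e : ℝ) (f : A) (v : GaugeIndex N → A) : A :=
  f - (1 / 3 : ℝ) • (3 - 3 * T + T ^ 2) - e • (1 - T) ^ 2
    + (2 * k) • ((1 - T) ^ 3 * J (T * f * kineticElt N v
        + (e / 4) • potentialElt N (omegaElt N a T J v)))

/-- The residual of the integrated Yang-Mills equation. -/
def yangMillsResidual (N : ℕ) (a : ℕ → ℝ) (k : ℝ) (T : A) (J : A →L[ℝ] A)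
    (e : ℝ) (f : A) (v : GaugeIndex N → A) (j : GaugeIndex N) : A :=
  f * v j + J ((2 * k) • ((1 - T) ^ 3 * kineticElt N v * (T * f * v j))
    + e • (weightElt (omegaElt N a T J v) j * omegaElt N a T J v j))

/-! ### Linearisation of the residuals at `e = 0`, and solvability for small `e` -/

theorem contDiff_extendFamily (N : ℕ) (j : ℕ) :
    ContDiff ℝ 1 fun p : ℝ × A × (GaugeIndex N → A) => extendFamily N p.2.2 j := by
  unfold extendFamily
  split_ifs <;> fun_prop

theorem contDiff_omegaElt (N : ℕ) (a : ℕ → ℝ) (T : A) (J : A →L[ℝ] A) (j : ℕ) :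
    ContDiff ℝ 1 fun p : ℝ × A × (GaugeIndex N → A) => omegaElt N a T J p.2.2 j := by
  unfold omegaElt
  have := contDiff_extendFamily (A := A) N j
  fun_prop

theorem contDiff_kineticElt (N : ℕ) :
    ContDiff ℝ 1 fun p : ℝ × A × (GaugeIndex N → A) => kineticElt N p.2.2 :=
  ContDiff.sum fun j _ => (contDiff_extendFamily N j).mul (contDiff_extendFamily N j)

theorem contDiff_potentialElt (N : ℕ) (a : ℕ → ℝ) (T : A) (J : A →L[ℝ] A) :
    ContDiff ℝ 1 fun p : ℝ × A × (GaugeIndex N → A) =>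
      potentialElt N (omegaElt N a T J p.2.2) := by
  refine ContDiff.sum fun j _ => ?_
  have h1 := contDiff_omegaElt N a T J j
  have h2 := contDiff_omegaElt N a T J (j - 1)
  fun_prop

theorem contDiff_weightElt (N : ℕ) (a : ℕ → ℝ) (T : A) (J : A →L[ℝ] A) (j : ℕ) :
    ContDiff ℝ 1 fun p : ℝ × A × (GaugeIndex N → A) =>
      weightElt (omegaElt N a T J p.2.2) j := by
  unfold weightElt
  have h1 := contDiff_omegaElt N a T J j
  have h2 := contDiff_omegaElt N a T J (j - 1)
  have h3 := contDiff_omegaElt N a T J (j + 1)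
  fun_prop

omit [NormedAlgebra ℝ A] in
theorem extendFamily_zero (N : ℕ) (j : ℕ) : extendFamily N (0 : GaugeIndex N → A) j = 0 := by
  unfold extendFamily
  split_ifs <;> rfl

/-- Kinetic terms are at least quadratic in `v`, so they drop out of the linearisation at `v = 0`.
-/
theorem hasStrictFDerivAt_mul_zero {X : Type*} [NormedAddCommGroup X] [NormedSpace ℝ X]
    {u w : X → A} {p : X} (hu : ContDiff ℝ 1 u) (hw : ContDiff ℝ 1 w) (hu0 : u p = 0)
    (hw0 : w p = 0) : HasStrictFDerivAt (fun x => u x * w x) (0 : X →L[ℝ] A) p := by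
  have h := (hu.contDiffAt.hasStrictFDerivAt (x := p) one_ne_zero).mul
    (hw.contDiffAt.hasStrictFDerivAt (x := p) one_ne_zero)
  exact h.congr_fderiv (by ext x; simp [hu0, hw0])

/-- At `e = 0`, a term with a factor `e` contributes only in the direction of `e`. -/
theorem hasStrictFDerivAt_fst_smul {Y : Type*} [NormedAddCommGroup Y] [NormedSpace ℝ Y]
    {w : ℝ × Y → A} {y : Y} (hw : ContDiff ℝ 1 w) :
    HasStrictFDerivAt (fun x => x.1 • w x)
      ((ContinuousLinearMap.fst ℝ ℝ Y).smulRight (w (0, y))) (0, y) := by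
  have h := (hasStrictFDerivAt_fst (𝕜 := ℝ) (p := ((0 : ℝ), y))).smul
    (hw.contDiffAt.hasStrictFDerivAt (x := ((0 : ℝ), y)) one_ne_zero)
  rwa [zero_smul, zero_add] at h

theorem hasStrictFDerivAt_kinetic (N : ℕ) (T f₀ : A) :
    HasStrictFDerivAt (fun p : ℝ × A × (GaugeIndex N → A) => T * p.2.1 * kineticElt N p.2.2)
      (0 : ℝ × A × (GaugeIndex N → A) →L[ℝ] A) (0, f₀, 0) := by
  have h : HasStrictFDerivAt (fun p : ℝ × A × (GaugeIndex N → A) =>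
      ∑ j ∈ Finset.Icc 1 (N - 1),
        (T * p.2.1 * extendFamily N p.2.2 j) * extendFamily N p.2.2 j)
      (∑ j ∈ Finset.Icc 1 (N - 1), (0 : ℝ × A × (GaugeIndex N → A) →L[ℝ] A)) (0, f₀, 0) := by
    refine HasStrictFDerivAt.fun_sum fun j _ => ?_
    have := contDiff_extendFamily (A := A) N j
    exact hasStrictFDerivAt_mul_zero (by fun_prop) this (by simp [extendFamily_zero])
      (by simp [extendFamily_zero])
  rw [Finset.sum_const_zero] at h
  convert h using 2 with p
  simp only [kineticElt, Finset.mul_sum, mul_assoc]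

theorem hasStrictFDerivAt_einsteinResidual (N : ℕ) (a : ℕ → ℝ) (k : ℝ) (T : A) (J : A →L[ℝ] A)
    (f₀ : A) : ∃ c : A, HasStrictFDerivAt
      (fun p : ℝ × A × (GaugeIndex N → A) => einsteinResidual N a k T J p.1 p.2.1 p.2.2)
      ((ContinuousLinearMap.fst ℝ A (GaugeIndex N → A)).comp
          (ContinuousLinearMap.snd ℝ ℝ (A × (GaugeIndex N → A)))
        + (ContinuousLinearMap.fst ℝ ℝ (A × (GaugeIndex N → A))).smulRight c) (0, f₀, 0) := by
  have h1 := hasStrictFDerivAt_kinetic N T f₀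
  have h2 := hasStrictFDerivAt_fst_smul (y := (f₀, (0 : GaugeIndex N → A)))
    ((contDiff_potentialElt N a T J).const_smul (1 / 4 : ℝ))
  have h3 := ((J.hasStrictFDerivAt.comp (0, f₀, 0) (h1.add h2)).const_mul
    ((1 - T) ^ 3)).const_smul (2 * k)
  have h4 := hasStrictFDerivAt_fst_smul (y := (f₀, (0 : GaugeIndex N → A)))
    (contDiff_const (c := (1 - T) ^ 2))
  have h5 : HasStrictFDerivAt (fun p : ℝ × A × (GaugeIndex N → A) => p.2.1) _ (0, f₀, 0) :=
    ((ContinuousLinearMap.fst ℝ A (GaugeIndex N → A)).comp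
          (ContinuousLinearMap.snd ℝ ℝ (A × (GaugeIndex N → A)))).hasStrictFDerivAt
  have h6 := ((h5.sub_const ((1 / 3 : ℝ) • (3 - 3 * T + T ^ 2))).sub h4).add h3
  refine ⟨(2 * k) • ((1 - T) ^ 3 * J ((1 / 4 : ℝ) • potentialElt N (omegaElt N a T J 0)))
    - (1 - T) ^ 2, ?_⟩
  refine (h6.congr_fderiv ?_).congr_of_eventuallyEq (Eventually.of_forall fun p => ?_)
  · refine ContinuousLinearMap.ext fun p => ?_
    simp [smul_sub, smul_comm p.1]
    abel
  · simp [einsteinResidual, smul_smul, div_eq_mul_inv]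

theorem hasStrictFDerivAt_yangMillsResidual (N : ℕ) (a : ℕ → ℝ) (k : ℝ) (T : A) (J : A →L[ℝ] A)
    (f₀ : A) (j : GaugeIndex N) : ∃ d : A, HasStrictFDerivAt
      (fun p : ℝ × A × (GaugeIndex N → A) => yangMillsResidual N a k T J p.1 p.2.1 p.2.2 j)
      (f₀ • ((ContinuousLinearMap.proj (R := ℝ) (φ := fun _ : GaugeIndex N => A) j).comp
          ((ContinuousLinearMap.snd ℝ A (GaugeIndex N → A)).comp
          (ContinuousLinearMap.snd ℝ ℝ (A × (GaugeIndex N → A)))))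
        + (ContinuousLinearMap.fst ℝ ℝ (A × (GaugeIndex N → A))).smulRight d) (0, f₀, 0) := by
  have hk := contDiff_kineticElt (A := A) N
  have h1 : HasStrictFDerivAt (fun p : ℝ × A × (GaugeIndex N → A) =>
      ((1 - T) ^ 3 * kineticElt N p.2.2) * (T * p.2.1 * p.2.2 j))
      (0 : ℝ × A × (GaugeIndex N → A) →L[ℝ] A) (0, f₀, 0) :=
    hasStrictFDerivAt_mul_zero (by fun_prop) (by fun_prop)
      (by simp [kineticElt, extendFamily_zero]) (by simp)
  have h2 := hasStrictFDerivAt_fst_smul (y := (f₀, (0 : GaugeIndex N → A)))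
    ((contDiff_weightElt N a T J j).mul (contDiff_omegaElt N a T J j))
  have h3 := J.hasStrictFDerivAt.comp (0, f₀, 0) ((h1.const_smul (2 * k)).add h2)
  have hv : HasStrictFDerivAt (fun p : ℝ × A × (GaugeIndex N → A) => p.2.2 j) _ (0, f₀, 0) :=
    ((ContinuousLinearMap.proj (R := ℝ) (φ := fun _ : GaugeIndex N => A) j).comp
          ((ContinuousLinearMap.snd ℝ A (GaugeIndex N → A)).comp
          (ContinuousLinearMap.snd ℝ ℝ (A × (GaugeIndex N → A))))).hasStrictFDerivAt
  have hf : HasStrictFDerivAt (fun p : ℝ × A × (GaugeIndex N → A) => p.2.1) _ (0, f₀, 0) :=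
    ((ContinuousLinearMap.fst ℝ A (GaugeIndex N → A)).comp
          (ContinuousLinearMap.snd ℝ ℝ (A × (GaugeIndex N → A)))).hasStrictFDerivAt
  have h4 := (hf.mul hv).add h3
  refine ⟨J (weightElt (omegaElt N a T J 0) j * omegaElt N a T J 0 j), ?_⟩
  refine (h4.congr_fderiv ?_).congr_of_eventuallyEq (Eventually.of_forall fun p => ?_)
  · refine ContinuousLinearMap.ext fun p => ?_
    simp
  · simp [yangMillsResidual]

/-- The map from `(e, f, v)` to `e` and the residuals has a surjective strict derivative, hence is
open at the base point. Keeping `e` in the target ensures that a preimage of `(e, 0, 0)` solves the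
equations with that same `e`; uniqueness is not needed. -/
theorem exists_solution [CompleteSpace A] (N : ℕ) (a : ℕ → ℝ) (k : ℝ) (T : A) (J : A →L[ℝ] A)
    {f₀ : A} (hf₀ : f₀ = (1 / 3 : ℝ) • (3 - 3 * T + T ^ 2)) (hu : IsUnit f₀)
    {U : Set (A × (GaugeIndex N → A))} (hU : U ∈ 𝓝 (f₀, 0)) :
    ∀ᶠ e in 𝓝 (0 : ℝ), ∃ f v, (f, v) ∈ U ∧ einsteinResidual N a k T J e f v = 0 ∧
      ∀ j, yangMillsResidual N a k T J e f v j = 0 := by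
  obtain ⟨c, hc⟩ := hasStrictFDerivAt_einsteinResidual N a k T J f₀
  choose d hd using hasStrictFDerivAt_yangMillsResidual N a k T J f₀
  have hΦ := (hasStrictFDerivAt_fst (𝕜 := ℝ)
    (p := ((0 : ℝ), f₀, (0 : GaugeIndex N → A)))).prodMk (hc.prodMk (hasStrictFDerivAt_pi.2 hd))
  obtain ⟨u, rfl⟩ := hu
  have hmap := hΦ.map_nhds_eq_of_surj (by
    rw [LinearMap.range_eq_top]
    rintro ⟨α, φ, ψ⟩
    -- Back substitution in a triangular system; the unit `u` is `f₀`.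
    refine ⟨(α, φ - α • c, fun j => ↑u⁻¹ * (ψ j - α • d j)), ?_⟩
    refine Prod.ext ?_ (Prod.ext ?_ (funext fun j => ?_)) <;> simp)
  have h0 : einsteinResidual N a k T J 0 (u : A) 0 = 0 := by
    simp [einsteinResidual, kineticElt, extendFamily_zero, hf₀]
  have h0' : yangMillsResidual N a k T J 0 (u : A) 0 = 0 := by
    ext j
    simp [yangMillsResidual, kineticElt, extendFamily_zero]
  have hV : Set.univ ×ˢ U ∈ 𝓝 ((0 : ℝ), (u : A), (0 : GaugeIndex N → A)) :=
    prod_mem_nhds univ_mem hU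
  have hI := image_mem_map (m := fun p : ℝ × A × (GaugeIndex N → A) =>
    (p.1, einsteinResidual N a k T J p.1 p.2.1 p.2.2,
      fun j => yangMillsResidual N a k T J p.1 p.2.1 p.2.2 j)) hV
  rw [hmap] at hI
  have hcont : ContinuousAt (fun e : ℝ => (e, (0 : A), (0 : GaugeIndex N → A))) 0 := by fun_prop
  have hval : ((0 : ℝ), einsteinResidual N a k T J 0 (u : A) 0,
      fun j => yangMillsResidual N a k T J 0 (u : A) 0 j) =
      ((0 : ℝ), (0 : A), (0 : GaugeIndex N → A)) := Prod.ext rfl (Prod.ext h0 h0')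
  have hI' := hcont.preimage_mem_nhds (hval ▸ hI)
  filter_upwards [hI'] with e he
  obtain ⟨⟨e', f, v⟩, hmem, heq⟩ := he
  simp only [Prod.mk.injEq] at heq
  obtain ⟨rfl, h1, h2⟩ := heq
  exact ⟨f, v, hmem.2, h1, congrFun h2⟩

end BanachAlgebra

end EYM

end

noncomputable section

namespace EYM

/-! ### The field equations in the compactified radial coordinate `t = 1 - rh / r` -/

/-- The sum of the squares of the derivatives of the gauge functions. -/
def kinetic (N : ℕ) (V : ℕ → ℝ → ℝ) (t : ℝ) : ℝ :=
  ∑ j ∈ Finset.Icc 1 (N - 1), V j t ^ 2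

/-- The sum of squares in the tangential pressure. -/
def potential (N : ℕ) (O : ℕ → ℝ → ℝ) (t : ℝ) : ℝ :=
  ∑ j ∈ Finset.Icc 1 N, (O j t ^ 2 - O (j - 1) t ^ 2 - (N : ℝ) - 1 + 2 * (j : ℝ)) ^ 2

/-- A solution of the field equations in the coordinate `t = 1 - rh / r`: rescaled metric function
`t f`, rescaled mass `n`, logarithm `Q` of `S`, gauge functions `O` and their derivatives `V`. -/
structure IsProfile (N : ℕ) (e k : ℝ) (f n Q : ℝ → ℝ) (O V : ℕ → ℝ → ℝ) : Prop where
  omega_zero : ∀ t, O 0 t = 0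
  omega_N : ∀ t, O N t = 0
  analytic_f : ∀ t, |t| < 3 / 2 → AnalyticAt ℝ f t
  analytic_n : ∀ t, |t| < 3 / 2 → AnalyticAt ℝ n t
  analytic_Q : ∀ t, |t| < 3 / 2 → AnalyticAt ℝ Q t
  analytic_O : ∀ j t, |t| < 3 / 2 → AnalyticAt ℝ (O j) t
  analytic_V : ∀ j t, |t| < 3 / 2 → AnalyticAt ℝ (V j) t
  mass : ∀ t, |t| < 3 / 2 → t * f t = e * (1 - t) ^ 2 - 2 * n t * (1 - t) ^ 3 + 1 / 3
  pos : ∀ t, 0 ≤ t → t ≤ 1 → 0 < f t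
  Q_one : Q 1 = 0
  deriv_O : ∀ j t, |t| < 3 / 2 → HasDerivAt (O j) (V j t) t
  deriv_n : ∀ t, |t| < 3 / 2 →
    HasDerivAt n (k * (t * f t * kinetic N V t + e / 4 * potential N O t)) t
  deriv_Q : ∀ t, |t| < 3 / 2 → HasDerivAt Q (2 * k * ((1 - t) ^ 3 * kinetic N V t)) t
  deriv_V : ∀ j, 1 ≤ j → j ≤ N - 1 → ∀ t, |t| < 3 / 2 →
    HasDerivAt (fun t => t * f t * V j t)
      (-(2 * k * ((1 - t) ^ 3 * kinetic N V t * (t * f t * V j t)) + e * (W O j t * O j t))) t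

/-- The compactified radial coordinate. -/
def compactCoord (rh r : ℝ) : ℝ := 1 - rh / r

section Coordinate

variable {rh r : ℝ}

theorem hasDerivAt_compactCoord (hr : r ≠ 0) :
    HasDerivAt (compactCoord rh) (rh / r ^ 2) r := by
  have h := ((hasDerivAt_inv hr).const_mul rh).const_sub 1
  refine h.congr_deriv ?_
  ring

theorem analyticAt_compactCoord (hr : r ≠ 0) : AnalyticAt ℝ (compactCoord rh) r :=
  analyticAt_const.sub (analyticAt_const.div analyticAt_id hr)

/-- Starting at `rh / 2` leaves a full neighbourhood of the horizon for two-sided derivatives. -/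
theorem abs_compactCoord_lt (hrh : 0 < rh) (hr : rh / 2 < r) : |compactCoord rh r| < 3 / 2 := by
  have hr0 : 0 < r := by linarith
  have h1 : rh / r < 2 := by rw [div_lt_iff₀ hr0]; linarith
  have h2 : 0 < rh / r := by positivity
  unfold compactCoord
  rw [abs_lt]
  constructor <;> linarith

theorem compactCoord_nonneg (hrh : 0 < rh) (hr : rh ≤ r) : 0 ≤ compactCoord rh r := by
  have : rh / r ≤ 1 := (div_le_one (hrh.trans_le hr)).2 hr
  unfold compactCoord
  linarith

theorem compactCoord_pos (hrh : 0 < rh) (hr : rh < r) : 0 < compactCoord rh r := by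
  have : rh / r < 1 := (div_lt_one (hrh.trans hr)).2 hr
  unfold compactCoord
  linarith

theorem compactCoord_le_one (hrh : 0 < rh) (hr : rh ≤ r) : compactCoord rh r ≤ 1 := by
  have : 0 < rh / r := div_pos hrh (hrh.trans_le hr)
  unfold compactCoord
  linarith

theorem compactCoord_self (hrh : 0 < rh) : compactCoord rh rh = 0 := by
  simp [compactCoord, hrh.ne']

/-- The coordinate is affine in `r⁻¹`. -/
theorem regularAtInfinity_comp_compactCoord {g : ℝ → ℝ} (hg : AnalyticAt ℝ g 1) :
    RegularAtInfinity (fun r => g (compactCoord rh r)) (g 1) := by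
  refine ⟨fun x => g (1 - rh * x), ?_, by simp, Eventually.of_forall fun r => ?_⟩
  · refine AnalyticAt.fun_comp (g := g) (f := fun x => 1 - rh * x) (by simpa using hg) ?_
    exact analyticAt_const.sub (analyticAt_const.mul analyticAt_id)
  · simp only [compactCoord, div_eq_mul_inv]

end Coordinate

/-! ### From a profile to a black hole -/

namespace IsProfile

variable {N : ℕ} {e k rh l : ℝ} {f n Q : ℝ → ℝ} {O V : ℕ → ℝ → ℝ}

theorem hasDerivAt_V (h : IsProfile N e k f n Q O V) (j : ℕ) {t : ℝ} (ht : |t| < 3 / 2) :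
    HasDerivAt (V j) (deriv (V j) t) t :=
  (h.analytic_V j t ht).differentiableAt.hasDerivAt

theorem hasDerivAt_mul_f (h : IsProfile N e k f n Q O V) {t : ℝ} (ht : |t| < 3 / 2) :
    HasDerivAt (fun t => t * f t) (-(2 * e * (1 - t)) + 6 * n t * (1 - t) ^ 2
      - 2 * (1 - t) ^ 3 * (k * (t * f t * kinetic N V t + e / 4 * potential N O t))) t := by
  have h1 : HasDerivAt (fun t : ℝ => 1 - t) (-1) t := (hasDerivAt_id t).const_sub 1
  have h2 := (((h1.pow 2).const_mul e).sub (((h.deriv_n t ht).const_mul 2).mul (h1.pow 3))).add_const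
    (1 / 3)
  have : ∀ᶠ s : ℝ in 𝓝 t, |s| < 3 / 2 := continuous_abs.continuousAt.eventually_lt_const ht
  refine (h2.congr_of_eventuallyEq ?_).congr_deriv ?_
  · filter_upwards [this] with s hs
    simpa using h.mass s hs
  · simp
    ring

/-- The product rule is compared with the divergence form `deriv_V`, avoiding division by `t f`,
which vanishes at the horizon. -/
theorem deriv_V_eq (h : IsProfile N e k f n Q O V) {j : ℕ} (h1 : 1 ≤ j) (h2 : j ≤ N - 1) {t : ℝ}
    (ht : |t| < 3 / 2) :
    (-(2 * e * (1 - t)) + 6 * n t * (1 - t) ^ 2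
      - 2 * (1 - t) ^ 3 * (k * (t * f t * kinetic N V t + e / 4 * potential N O t))) * V j t
      + t * f t * deriv (V j) t =
    -(2 * k * ((1 - t) ^ 3 * kinetic N V t * (t * f t * V j t)) + e * (W O j t * O j t)) :=
  ((h.hasDerivAt_mul_f ht).mul (h.hasDerivAt_V j ht)).unique (h.deriv_V j h1 h2 t ht)

theorem hasDerivAt_omega (h : IsProfile N e k f n Q O V) (hrh : 0 < rh) (j : ℕ) {r : ℝ}
    (hr : rh / 2 < r) : HasDerivAt (fun r => O j (compactCoord rh r))
      (V j (compactCoord rh r) * (rh / r ^ 2)) r :=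
  (h.deriv_O j _ (abs_compactCoord_lt hrh hr)).comp r
    (hasDerivAt_compactCoord (by linarith : (0 : ℝ) < r).ne')

theorem hasDerivAt_deriv_omega (h : IsProfile N e k f n Q O V) (hrh : 0 < rh) (j : ℕ) {r : ℝ}
    (hr : rh / 2 < r) : HasDerivAt (deriv fun r => O j (compactCoord rh r))
      (deriv (V j) (compactCoord rh r) * (rh / r ^ 2) * (rh / r ^ 2)
        + V j (compactCoord rh r) * (-(2 * rh / r ^ 3))) r := by
  have hr0 : r ≠ 0 := (by linarith : (0 : ℝ) < r).ne'
  have h1 := (h.hasDerivAt_V j (abs_compactCoord_lt hrh hr)).comp r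
    (hasDerivAt_compactCoord (rh := rh) hr0)
  have h2 : HasDerivAt (fun r : ℝ => rh / r ^ 2) (-(2 * rh / r ^ 3)) r := by
    have := ((hasDerivAt_pow 2 r).inv (pow_ne_zero 2 hr0)).const_mul rh
    refine (this.congr_deriv ?_)
    field_simp
    norm_num
    ring
  refine (h1.mul h2).congr_of_eventuallyEq ?_
  filter_upwards [lt_mem_nhds hr] with s hs
  exact (h.hasDerivAt_omega hrh j hs).deriv

theorem hasDerivAt_mass (h : IsProfile N e k f n Q O V) (hrh : 0 < rh) {r : ℝ}
    (hr : rh / 2 < r) : HasDerivAt (fun r => l * rh ^ 3 * n (compactCoord rh r))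
      (l * rh ^ 3 * (k * (compactCoord rh r * f (compactCoord rh r)
        * kinetic N V (compactCoord rh r) + e / 4 * potential N O (compactCoord rh r))
        * (rh / r ^ 2))) r :=
  ((h.deriv_n _ (abs_compactCoord_lt hrh hr)).comp r
    (hasDerivAt_compactCoord (by linarith : (0 : ℝ) < r).ne')).const_mul _

theorem hasDerivAt_S (h : IsProfile N e k f n Q O V) (hrh : 0 < rh) {r : ℝ}
    (hr : rh / 2 < r) : HasDerivAt (fun r => Real.exp (Q (compactCoord rh r)))
      (Real.exp (Q (compactCoord rh r)) * (2 * k * ((1 - compactCoord rh r) ^ 3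
        * kinetic N V (compactCoord rh r)) * (rh / r ^ 2))) r :=
  ((h.deriv_Q _ (abs_compactCoord_lt hrh hr)).comp r
    (hasDerivAt_compactCoord (by linarith : (0 : ℝ) < r).ne')).exp

theorem mu_eq (h : IsProfile N e k f n Q O V) (hrh : 0 < rh) (he : l * rh ^ 2 * e = 1) {r : ℝ}
    (hr : rh / 2 < r) : mu (-l) (fun r => l * rh ^ 3 * n (compactCoord rh r)) r =
      l * r ^ 2 * (compactCoord rh r * f (compactCoord rh r)) := by
  have hr0 : r ≠ 0 := (by linarith : (0 : ℝ) < r).ne'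
  rw [h.mass _ (abs_compactCoord_lt hrh hr), mu]
  have : 1 - compactCoord rh r = rh / r := by simp [compactCoord]
  rw [this]
  field_simp
  linear_combination (-3 * r) * he

theorem G_eq (h : IsProfile N e k f n Q O V) (hrh : 0 < rh) {r : ℝ} (hr : rh / 2 < r) :
    G N (fun j r => O j (compactCoord rh r)) r =
      (rh / r ^ 2) ^ 2 * kinetic N V (compactCoord rh r) := by
  rw [G, kinetic, Finset.mul_sum]
  refine Finset.sum_congr rfl fun j _ => ?_
  rw [(h.hasDerivAt_omega hrh j hr).deriv]
  ring

theorem fieldEquationsAt (h : IsProfile N e k f n Q O V) (hrh : 0 < rh)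
    (he : l * rh ^ 2 * e = 1) (hk : k * rh ^ 2 = 1) {r : ℝ} (hr : rh / 2 < r) :
    FieldEquationsAt N (-l) (fun r => l * rh ^ 3 * n (compactCoord rh r))
      (fun r => Real.exp (Q (compactCoord rh r))) (fun j r => O j (compactCoord rh r)) r := by
  have hr0 : r ≠ 0 := (by linarith : (0 : ℝ) < r).ne'
  have ht := abs_compactCoord_lt hrh hr
  have hp : pTheta N (fun j r => O j (compactCoord rh r)) r =
    1 / (4 * r ^ 4) * potential N O (compactCoord rh r) := rfl
  have hz : compactCoord rh r = 1 - rh / r := rfl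
  have hl : l ≠ 0 := by rintro rfl; simp at he
  have he' : e = 1 / (l * rh ^ 2) := by field_simp; linarith
  have hk' : k = 1 / rh ^ 2 := by field_simp; linarith
  refine ⟨fun j h1 h2 => ?_, ?_, ?_⟩
  · have hW : W (fun j r => O j (compactCoord rh r)) j r = W O j (compactCoord rh r) := rfl
    have hm := h.mass _ ht
    have hV := h.deriv_V_eq h1 h2 ht
    rw [h.mu_eq hrh he hr, (h.hasDerivAt_deriv_omega hrh j hr).deriv,
      (h.hasDerivAt_omega hrh j hr).deriv, hp, hW]
    generalize compactCoord rh r = t at *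
    generalize deriv (V j) t = V' at *
    generalize V j t = Vt at *
    generalize W O j t = Wt at *
    generalize O j t = Ot at *
    generalize potential N O t = P at *
    generalize kinetic N V t = K at *
    generalize n t = nt at *
    generalize t * f t = F at *
    have hz' : 1 - t = rh / r := by rw [hz]; ring
    rw [hz'] at hV hm
    rw [he', hk'] at hV
    rw [he'] at hm
    -- The factor `l * rh ^ 2` undoes the scaling by `e`; `hm` eliminates `F` from the first-order
    -- term that the chain rule adds to `ω''`.
    linear_combination (norm := skip) (l * rh ^ 2) * hV - (2 * l * r * rh * Vt) * hm
    field_simp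
    ring
  · rw [(h.hasDerivAt_mass hrh hr).deriv, h.mu_eq hrh he hr, h.G_eq hrh hr, hp, he', hk']
    field_simp
  · rw [(h.hasDerivAt_S hrh hr).deriv, h.G_eq hrh hr, hk', hz, mul_div_cancel_left₀ _
      (Real.exp_ne_zero _)]
    field_simp
    ring

theorem isBlackHole (h : IsProfile N e k f n Q O V) (hrh : 0 < rh) (hl : 0 < l)
    (he : l * rh ^ 2 * e = 1) (hk : k * rh ^ 2 = 1) :
    IsBlackHole N (-l) rh (fun r => l * rh ^ 3 * n (compactCoord rh r))
      (fun r => Real.exp (Q (compactCoord rh r))) (fun j r => O j (compactCoord rh r)) where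
  omega_zero r := h.omega_zero _
  omega_N r := h.omega_N _
  analytic_m := analyticAt_const.mul ((h.analytic_n _ (abs_compactCoord_lt hrh (by linarith))).comp
    (analyticAt_compactCoord hrh.ne'))
  analytic_S := ((h.analytic_Q _ (abs_compactCoord_lt hrh (by linarith))).comp
    (analyticAt_compactCoord hrh.ne')).rexp
  analytic_omega j _ _ := (h.analytic_O j _ (abs_compactCoord_lt hrh (by linarith))).comp
    (analyticAt_compactCoord hrh.ne')
  mu_horizon := by
    rw [h.mu_eq hrh he (by linarith), compactCoord_self hrh]
    ring
  nonextremal := by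
    have h0 : |compactCoord rh rh| < 3 / 2 := abs_compactCoord_lt hrh (by linarith)
    have h1 := (hasDerivAt_id (compactCoord rh rh)).mul
      (h.analytic_f _ h0).differentiableAt.hasDerivAt
    have h2 := h1.comp rh (hasDerivAt_compactCoord hrh.ne')
    have h3 := ((hasDerivAt_pow 2 rh).const_mul l).mul h2
    have h4 : HasDerivAt (mu (-l) fun r => l * rh ^ 3 * n (compactCoord rh r))
        (l * rh * f 0) rh := by
      refine (h3.congr_of_eventuallyEq ?_).congr_deriv ?_
      · filter_upwards [lt_mem_nhds (by linarith : rh / 2 < rh)] with s hs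
        exact h.mu_eq hrh he hs
      · simp [compactCoord_self hrh]
        field_simp
    rw [h4.deriv]
    have := h.pos 0 le_rfl zero_le_one
    positivity
  mu_pos r hr := by
    rw [h.mu_eq hrh he (by linarith)]
    have h1 := compactCoord_pos hrh hr
    have h2 := h.pos _ h1.le (compactCoord_le_one hrh hr.le)
    have : 0 < r := hrh.trans hr
    positivity
  S_pos r _ := Real.exp_pos _
  differentiable_m r hr := (h.hasDerivAt_mass hrh (by linarith)).differentiableAt
  differentiable_S r hr := (h.hasDerivAt_S hrh (by linarith)).differentiableAt
  differentiable_omega j _ _ r hr := (h.hasDerivAt_omega hrh j (by linarith)).differentiableAt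
  differentiable_deriv_omega j _ _ r hr :=
    (h.hasDerivAt_deriv_omega hrh j (by linarith)).differentiableAt
  field_equations r hr := h.fieldEquationsAt hrh he hk (by linarith)
  infinity_m := ⟨_, regularAtInfinity_comp_compactCoord (g := fun t => l * rh ^ 3 * n t)
    (analyticAt_const.mul (h.analytic_n 1 (by norm_num)))⟩
  infinity_S := by
    have := regularAtInfinity_comp_compactCoord (rh := rh) (g := fun t => Real.exp (Q t))
      (h.analytic_Q 1 (by norm_num)).rexp
    rwa [h.Q_one, Real.exp_zero] at this
  infinity_omega j _ _ := ⟨_, regularAtInfinity_comp_compactCoord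
    (h.analytic_O j 1 (by norm_num))⟩

end IsProfile

end EYM

end

noncomputable section

namespace EYM

/-! ### From a zero of the residuals to a profile -/

open DiscAlgebra in
theorem eval_omegaElt (N : ℕ) (a : ℕ → ℝ) (v : GaugeIndex N → DiscAlgebra) (j : ℕ) {t : ℝ}
    (ht : |t| ≤ 3 / 2) : eval t (omegaElt N a T avg v j) =
      (if j ∈ Finset.Icc 1 (N - 1) then a j else 0) + t * eval t (avg (extendFamily N v j)) := by
  rw [omegaElt, map_add, map_mul, eval_T ht, AlgHom.commutes]
  rfl

open DiscAlgebra in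
theorem eval_omegaElt_of_notMem {N : ℕ} (a : ℕ → ℝ) (v : GaugeIndex N → DiscAlgebra) {j : ℕ}
    (hj : j ∉ Finset.Icc 1 (N - 1)) (t : ℝ) : eval t (omegaElt N a T avg v j) = 0 := by
  rw [omegaElt, if_neg hj, extendFamily, dif_neg hj, map_zero, zero_add, map_mul,
    map_zero avg, map_zero, mul_zero]

-- The constant `(e + 1 / 3) / 2` is the value of `n` forced by `t f = 0` at the horizon; the one
-- subtracted from `Q` makes `S → 1` at infinity.
open DiscAlgebra in
theorem isProfile_of_residual_eq_zero {N : ℕ} {a : ℕ → ℝ} {e k : ℝ} {f : DiscAlgebra}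
    {v : GaugeIndex N → DiscAlgebra} (hE : einsteinResidual N a k T avg e f v = 0)
    (hY : ∀ j, yangMillsResidual N a k T avg e f v j = 0)
    (hf : ‖f - (1 / 3 : ℝ) • (3 - 3 * T + T ^ 2)‖ < 1 / 3) :
    IsProfile N e k (fun t => eval t f)
      (fun t => (e + 1 / 3) / 2 + t * eval t (avg (k • (T * f * kineticElt N v
        + (e / 4) • potentialElt N (omegaElt N a T avg v)))))
      (fun t => t * eval t (avg ((2 * k) • ((1 - T) ^ 3 * kineticElt N v)))
        - eval 1 (avg ((2 * k) • ((1 - T) ^ 3 * kineticElt N v))))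
      (fun j t => eval t (omegaElt N a T avg v j)) (fun j t => eval t (extendFamily N v j)) := by
  have hK : ∀ t, eval t (kineticElt N v) =
      kinetic N (fun j t => eval t (extendFamily N v j)) t := fun t => by
    simp [kineticElt, kinetic, sq]
  have hP : ∀ t, eval t (potentialElt N (omegaElt N a T avg v)) =
      potential N (fun j t => eval t (omegaElt N a T avg v j)) t := fun t => by
    simp [potentialElt, potential]
  have hW : ∀ j t, eval t (weightElt (omegaElt N a T avg v) j) =
      W (fun j t => eval t (omegaElt N a T avg v j)) j t := fun j t => by
    simp [weightElt, W]
    ring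
  refine ⟨?_, ?_, fun t ht => analyticAt_eval _ ht, ?_, ?_, fun j t ht => analyticAt_eval _ ht,
    fun j t ht => analyticAt_eval _ ht, ?_, ?_,
    by rw [one_mul, sub_self], ?_, ?_, ?_, ?_⟩
  · exact eval_omegaElt_of_notMem a v (by simp)
  · exact eval_omegaElt_of_notMem a v (by rw [Finset.mem_Icc]; omega)
  · intro t ht
    exact analyticAt_const.add (analyticAt_id.mul (analyticAt_eval _ ht))
  · intro t ht
    exact (analyticAt_id.mul (analyticAt_eval _ ht)).sub analyticAt_const
  · intro t ht
    have h := congrArg (eval t) hE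
    simp only [einsteinResidual, map_add, map_sub, map_smul, map_mul, map_pow, map_one, map_zero,
      map_ofNat, eval_T ht.le, smul_eq_mul] at h ⊢
    -- Uses `(1 - t)² - (1 - t)³ = t (1 - t)²` and `1 - (1 - t)³ = t (3 - 3t + t²)`.
    linear_combination t * h
  · intro t h0 h1
    have ht : |t| ≤ 3 / 2 := by rw [abs_of_nonneg h0]; linarith
    have h := (abs_eval_le t _).trans_lt hf
    simp only [map_add, map_sub, map_smul, map_mul, map_pow, map_ofNat, eval_T ht,
      smul_eq_mul] at h
    have := (abs_lt.1 h).1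
    -- On `[0, 1]`, `f₀ - 1/3 = (1 - t)(2 - t) / 3 ≥ 0`, so an error below `1/3` leaves `f > 0`.
    nlinarith
  · intro j t ht
    have h := (hasDerivAt_mul_eval_avg (extendFamily N v j) ht).const_add
      (if j ∈ Finset.Icc 1 (N - 1) then a j else 0)
    refine h.congr_of_eventuallyEq ?_
    have : ∀ᶠ s : ℝ in 𝓝 t, |s| < 3 / 2 := continuous_abs.continuousAt.eventually_lt_const ht
    filter_upwards [this] with s hs
    exact eval_omegaElt N a v j hs.le
  · intro t ht
    refine ((hasDerivAt_mul_eval_avg _ ht).const_add _).congr_deriv ?_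
    simp only [map_add, map_smul, map_mul, eval_T ht.le, smul_eq_mul, hK, hP]
  · intro t ht
    refine ((hasDerivAt_mul_eval_avg _ ht).sub_const _).congr_deriv ?_
    simp only [map_sub, map_smul, map_mul, map_pow, map_one, eval_T ht.le, smul_eq_mul, hK]
  · intro j h1 h2 t ht
    have hj : j ∈ Finset.Icc 1 (N - 1) := Finset.mem_Icc.2 ⟨h1, h2⟩
    have hv : extendFamily N v j = v ⟨j, hj⟩ := dif_pos hj
    have hy := hY ⟨j, hj⟩
    rw [yangMillsResidual] at hy
    have hy' := eq_neg_of_add_eq_zero_left hy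
    refine ((hasDerivAt_mul_eval_avg
      ((2 * k) • ((1 - T) ^ 3 * kineticElt N v * (T * f * v ⟨j, hj⟩))
        + e • (weightElt (omegaElt N a T avg v) j * omegaElt N a T avg v j))
      ht).neg.congr_of_eventuallyEq (Eventually.of_forall fun s => ?_)).congr_deriv ?_
    · have := congrArg (eval s) hy'
      rw [map_mul, map_neg] at this
      simp only [hv, mul_assoc]
      rw [this]
      simp only [mul_assoc, Pi.neg_apply]
      ring
    · simp only [map_add, map_sub, map_smul, map_mul, map_pow, map_one, eval_T ht.le, smul_eq_mul,
        hK, hW, hv]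

open DiscAlgebra in
theorem exists_profile (N : ℕ) (a : ℕ → ℝ) (ha : ∀ j, 1 ≤ j → j ≤ N - 1 → a j ≠ 0) (k : ℝ) :
    ∀ᶠ e in 𝓝 (0 : ℝ), ∃ f n Q O V, IsProfile N e k f n Q O V ∧
      (∀ j, 1 ≤ j → j ≤ N - 1 → O j 0 = a j) ∧
      (∀ j, 1 ≤ j → j ≤ N - 1 → ∀ t, 0 ≤ t → t ≤ 1 → O j t ≠ 0) := by
  -- Two open conditions: the first gives positivity of `f`, the second keeps `ω_j` from reaching
  -- zero. The latter admits `v = 0` because `a j ≠ 0`.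
  have hU : {p : DiscAlgebra × (GaugeIndex N → DiscAlgebra) |
      ‖p.1 - (1 / 3 : ℝ) • (3 - 3 * T + T ^ 2)‖ < 1 / 3 ∧
      ∀ j : GaugeIndex N, ‖T * avg (p.2 j)‖ < |a j|} ∈
      𝓝 ((1 / 3 : ℝ) • (3 - 3 * T + T ^ 2), (0 : GaugeIndex N → DiscAlgebra)) := by
    have h1 : Continuous fun p : DiscAlgebra × (GaugeIndex N → DiscAlgebra) =>
        ‖p.1 - (1 / 3 : ℝ) • (3 - 3 * T + T ^ 2)‖ := (continuous_fst.sub continuous_const).norm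
    have h2 (j : GaugeIndex N) : Continuous fun p : DiscAlgebra × (GaugeIndex N → DiscAlgebra) =>
        ‖T * avg (p.2 j)‖ :=
      (continuous_const.mul (avg.continuous.comp ((continuous_apply j).comp continuous_snd))).norm
    refine inter_mem (h1.continuousAt.eventually_lt_const ?_)
      (eventually_all.2 fun j => (h2 j).continuousAt.eventually_lt_const ?_)
    · beta_reduce
      rw [sub_self, norm_zero]
      norm_num
    · have := Finset.mem_Icc.1 j.2
      beta_reduce
      rw [show ((1 / 3 : ℝ) • (3 - 3 * T + T ^ 2), (0 : GaugeIndex N → DiscAlgebra)).2 j = 0 from rfl,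
        map_zero, mul_zero, norm_zero]
      exact abs_pos.2 (ha j this.1 this.2)
  filter_upwards [exists_solution N a k T avg rfl isUnit_mass hU] with e ⟨f, v, hm, hE, hY⟩
  refine ⟨_, _, _, _, _, isProfile_of_residual_eq_zero hE hY hm.1, ?_, ?_⟩
  · intro j h1 h2
    rw [eval_omegaElt N a v j (by norm_num), if_pos (Finset.mem_Icc.2 ⟨h1, h2⟩), zero_mul,
      add_zero]
  · intro j h1 h2 t h0 ht1 hzero
    have hj : j ∈ Finset.Icc 1 (N - 1) := Finset.mem_Icc.2 ⟨h1, h2⟩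
    have hlt := (abs_eval_le t _).trans_lt (hm.2 ⟨j, hj⟩)
    have hv : extendFamily N v j = v ⟨j, hj⟩ := dif_pos hj
    rw [omegaElt, map_add, AlgHom.commutes, if_pos hj, hv] at hzero
    -- At a zero, the perturbation would equal `-a j`, although its norm is below `|a j|`.
    rw [← neg_eq_of_add_eq_zero_right hzero, abs_neg] at hlt
    exact lt_irrefl _ hlt

end EYM

end

theorem mainTheorem3 (N : ℕ) (hN : 2 ≤ N) (rh : ℝ) (hrh : 0 < rh)
    (a : ℕ → ℝ) (ha : ∀ j, 1 ≤ j → j ≤ N - 1 → a j ≠ 0) :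
    ∃ L : ℝ, 0 < L ∧ ∀ Λ : ℝ, Λ < 0 → L < |Λ| →
      ∃ (m S : ℝ → ℝ) (ω : ℕ → ℝ → ℝ),
        EYM.IsBlackHole N Λ rh m S ω ∧
        (∀ j, 1 ≤ j → j ≤ N - 1 → ω j rh = a j) ∧
        (∀ j, 1 ≤ j → j ≤ N - 1 → ∀ r, rh ≤ r → ω j r ≠ 0) := by
  obtain ⟨δ, hδ, h⟩ := Metric.eventually_nhds_iff.1 (EYM.exists_profile N a ha (1 / rh ^ 2))
  -- This threshold makes `|Λ| > L` equivalent to `e = 1 / (|Λ| rh²) < δ`.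
  refine ⟨1 / (rh ^ 2 * δ), by positivity, fun Λ hΛ hL => ?_⟩
  rw [abs_of_neg hΛ] at hL
  have hl : 0 < -Λ := by linarith
  have he : dist (1 / (-Λ * rh ^ 2)) 0 < δ := by
    rw [Real.dist_0_eq_abs, abs_of_pos (by positivity), div_lt_iff₀ (by positivity)]
    rw [div_lt_iff₀ (by positivity)] at hL
    linarith
  obtain ⟨f, n, Q, O, V, hp, h0, hne⟩ := h he
  have hbh := hp.isBlackHole (l := -Λ) hrh hl (by field_simp; exact div_self hΛ.ne) (by field_simp)
  rw [neg_neg] at hbh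
  refine ⟨_, _, _, hbh, fun j h1 h2 => ?_, fun j h1 h2 r hr => ?_⟩
  · rw [EYM.compactCoord_self hrh]
    exact h0 j h1 h2
  · exact hne j h1 h2 _ (EYM.compactCoord_nonneg hrh hr) (EYM.compactCoord_le_one hrh hr)
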